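/- Let $G_2(\mathbb C)$ have simple roots $\alpha_1$ (short) and $\alpha_2$ (long), fundamental weights $\varpi_1=2\alpha_1+\alpha_2$ and $\varpi_2=3\alpha_1+2\alpha_2$, $\rho=\varpi_1+\varpi_2$, set $\Phi^+$ of positive roots, and Weyl group $W$ with length function $\ell$. For integers $n,m\ge 0$ let $\chi_{(n,m)}$ be the character of the irreducible finite-dimensional rational representation of $G_2(\mathbb C)$ with highest weight $n\varpi_1+m\varpi_2$. Fix $\tau\in G_2(\mathbb C)$ and $q\in\mathbb C$ with $|q|>1$ (for instance, $q$ the cardinality of a finite field). Define polynomials $P_\nu(t)\in\mathbb Z[t]$ by $\prod_{\alpha\in\Phi^+}(1-t\,e^{-\alpha})=\sum_{\nu\in S_0}P_\nu(t)\,e^{-\nu}$, where $S_0$ is the set of weights that are sums of distinct positive roots. For a weight $\mu$ put $\widetilde\chi_\mu=(-1)^{\ell(w)}\chi_{w\mu-\rho}(\tau)$ if there is a (necessarily unique) $w\in W$ with $w\mu$ strictly dominant, and $\widetilde\chi_\mu=0$ otherwise. For $\varpi=n\varpi_1+m\varpi_2$ with $n,m\ge0$ let $$Q_{\varpi}=\begin{cases}\dfrac{(1-q^{-2})(1-q^{-6})}{(1-q^{-1})^2},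 & n=m=0,\\[1ex] 1+q^{-1}, & \text{exactly one of } n,m \text{ is } 0,\\ 1, & n,m>0,\end{cases}\qquad p(n,m)=\frac1{Q_\varpi}\sum_{\nu\in S_0}P_\nu(q^{-1})\,\widetilde\chi_{\varpi+\rho-\nu}.$$ Put $$I_0(n,m;x,q)=(1-xq^6)(1-x^3q^{21})-(1-xq^5)(1-xq^6)(xq^8)^{m+1}-(1-xq^8)(1-xq^5)(xq^8)^m(xq^7)^{n+1},$$ $$z_0(x,q)=(1-xq^5)(1-xq^6)(1-xq^7)(1-xq^8)(1-x^2q^{14})(1-x^3q^{21}).$$ **Theorem.** As formal power series in $x$ with complex coefficients, $$\sum_{n,m\ge0}p(n,m)\,I_0(n,m;x,q)\,x^{n+2m}q^{8n+15m}=z_0(x,q)\sum_{r\ge0}\chi_{(r,0)}(\tau)\,x^rq^{8r}.$$ Moreover, for every complex number $x$ with $|xq^8|\le 1$ for which $\sum_{n,m\ge0}\chi_{(n,m)}(\tau)\,x^{n+2m}q^{8n+15m}$ converges absolutely, both sums in the identity converge absolutely and the identity holds as an equality of complex numbers. -/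

import Mathlib

open scoped PowerSeries.WithPiTopology

namespace G2Unramified

noncomputable section

/-! ### The group `G₂(ℂ)` and its irreducible rational representations -/

/-- The alternating trilinear form on `ℂ⁷` given by
`e¹⁴⁷ + e²⁴⁶ + e³⁴⁵ + e¹⁵⁶ + e²³⁷` (basis numbered from `1`), where `eᵃᵇᶜ` is the determinant
of the coordinates `a, b, c`. It is a generic three-form, and `e₁, …, e₇` are weight vectors of
weights `2α₁+α₂, α₁+α₂, α₁, 0, -α₁, -(α₁+α₂), -(2α₁+α₂)`, in decreasing order (`α₁` is the short
simple root, `α₂` the long one). -/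
def threeForm (u v w : Fin 7 → ℂ) : ℂ :=
  let e (a b c : Fin 7) : ℂ := Matrix.det !![u a, u b, u c; v a, v b, v c; w a, w b, w c]
  e 0 3 6 + e 1 3 5 + e 2 3 4 + e 0 4 5 + e 1 2 6

/-- `G₂(ℂ)`: the stabilizer in `SL₇(ℂ)` of the generic three-form. -/
def G2 : Subgroup (Matrix.SpecialLinearGroup (Fin 7) ℂ) where
  carrier := {g | ∀ u v w : Fin 7 → ℂ, threeForm (g.1.mulVec u) (g.1.mulVec v) (g.1.mulVec w) =
    threeForm u v w}
  one_mem' := by intro u v w; simp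
  mul_mem' := by
    intro a b ha hb u v w
    have h := ha (b.1.mulVec u) (b.1.mulVec v) (b.1.mulVec w)
    simp only [Matrix.mulVec_mulVec] at h
    rw [Matrix.SpecialLinearGroup.coe_mul, h, hb]
  inv_mem' := by
    intro a ha u v w
    have h := ha ((a⁻¹).1.mulVec u) ((a⁻¹).1.mulVec v) ((a⁻¹).1.mulVec w)
    simp only [Matrix.mulVec_mulVec, ← Matrix.SpecialLinearGroup.coe_mul, mul_inv_cancel,
      Matrix.SpecialLinearGroup.coe_one, Matrix.one_mulVec] at h
    exact h.symm

/-- A representation of `G₂(ℂ)` is rational (algebraic) if its matrix coefficients are polynomial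
functions of the matrix entries. -/
def IsRational {V : Type*} [AddCommGroup V] [Module ℂ V] (ρ : Representation ℂ G2 V) : Prop :=
  ∀ (f : Module.Dual ℂ V) (v : V), ∃ P : MvPolynomial (Fin 7 × Fin 7) ℂ,
    ∀ g : G2, f (ρ g v) = MvPolynomial.eval (fun ij => g.1.1 ij.1 ij.2) P

/-- `ρ` has a highest weight vector of weight `n ϖ₁ + m ϖ₂`. The Borel subgroup consists of the
upper triangular elements `b` of `G₂(ℂ)`. As a character of it `ϖ₁ = 2α₁+α₂` is `b ↦ b₁₁`
and `ϖ₂ = 3α₁+2α₂ = (2α₁+α₂) + (α₁+α₂)` is `b ↦ b₁₁ b₂₂`. -/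
def HasHighestWeight {V : Type*} [AddCommGroup V] [Module ℂ V] (ρ : Representation ℂ G2 V)
    (n m : ℕ) : Prop :=
  ∃ v : V, v ≠ 0 ∧ ∀ b : G2, (∀ i j : Fin 7, j < i → b.1.1 i j = 0) →
    ρ b v = ((b.1.1 0 0) ^ n * (b.1.1 0 0 * b.1.1 1 1) ^ m) • v

/-- `ρ` is the irreducible finite-dimensional rational representation of `G₂(ℂ)` with highest
weight `n ϖ₁ + m ϖ₂`. -/
structure IsIrrepOfHighestWeight {V : Type*} [AddCommGroup V] [Module ℂ V]
    (ρ : Representation ℂ G2 V) (n m : ℕ) : Prop where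
  finiteDimensional : FiniteDimensional ℂ V
  rational : IsRational ρ
  irreducible : ρ.IsIrreducible
  highestWeight : HasHighestWeight ρ n m

/-! ### Weights, roots and the Weyl group -/

/-- The weight lattice; `![a, b]` is `a ϖ₁ + b ϖ₂`. -/
abbrev Weight : Type := Fin 2 → ℤ

/-- The positive roots
`α₁ = 2ϖ₁-ϖ₂`, `α₂ = -3ϖ₁+2ϖ₂`, `α₁+α₂`, `2α₁+α₂ = ϖ₁`, `3α₁+α₂`, `3α₁+2α₂ = ϖ₂`. -/
def posRoots : Finset Weight :=
  {![2, -1], ![-3, 2], ![-1, 1], ![1, 0], ![3, -1], ![0, 1]}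

/-- `ρ = ϖ₁ + ϖ₂`, half the sum of the positive roots. -/
def rho : Weight := ![1, 1]

/-- The reflection in `α₁`, in the basis `ϖ₁, ϖ₂`. -/
def s₁ : Matrix (Fin 2) (Fin 2) ℤ := !![-1, 0; 1, 1]

/-- The reflection in `α₂`, in the basis `ϖ₁, ϖ₂`. -/
def s₂ : Matrix (Fin 2) (Fin 2) ℤ := !![1, 3; 0, -1]

/-- The Weyl group, the group of order `12` generated by `s₁` and `s₂`: the rotations
`(s₁ s₂)ᵏ` and the reflections `(s₁ s₂)ᵏ s₁`. -/
def weylGroup : Finset (Matrix (Fin 2) (Fin 2) ℤ) :=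
  (Finset.range 6).image (fun k => (s₁ * s₂) ^ k) ∪
    (Finset.range 6).image (fun k => (s₁ * s₂) ^ k * s₁)

set_option maxRecDepth 10000 in
theorem coe_weylGroup :
    (weylGroup : Set (Matrix (Fin 2) (Fin 2) ℤ)) = Submonoid.closure {s₁, s₂} := by
  have hmul : ∀ w ∈ weylGroup, w * s₁ ∈ weylGroup ∧ w * s₂ ∈ weylGroup := by decide
  have h1 : s₁ ∈ Submonoid.closure {s₁, s₂} := Submonoid.subset_closure (by simp)
  have h2 : s₂ ∈ Submonoid.closure {s₁, s₂} := Submonoid.subset_closure (by simp)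
  apply Set.Subset.antisymm
  · intro w hw
    simp only [weylGroup, Finset.coe_union, Finset.coe_image, Set.mem_union, Set.mem_image] at hw
    rcases hw with ⟨k, -, rfl⟩ | ⟨k, -, rfl⟩
    · exact pow_mem (mul_mem h1 h2) k
    · exact mul_mem (pow_mem (mul_mem h1 h2) k) h1
  · intro w hw
    induction hw using Submonoid.closure_induction_right with
    | one => exact (by decide : (1 : Matrix (Fin 2) (Fin 2) ℤ) ∈ weylGroup)
    | mul_right x hx y hy ih =>
      rcases hy with rfl | rfl
      · exact (hmul x ih).1
      · exact (hmul x ih).2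

/-! ### The weights `p(n,m)` -/

/-- `∏_{α > 0} (1 - t e^{-α})` in the group algebra of the weight lattice over `ℤ[t]`. -/
def tDenominator : AddMonoidAlgebra (Polynomial ℤ) Weight :=
  ∏ α ∈ posRoots, (1 - AddMonoidAlgebra.single (-α) Polynomial.X)

/-- The polynomials `P_ν(t)`, defined by `∏_{α > 0} (1 - t e^{-α}) = ∑_ν P_ν(t) e^{-ν}`. -/
def P (ν : Weight) : Polynomial ℤ := tDenominator.coeff (-ν)

/-- `S₀`: the weights that are sums of distinct positive roots. -/
def S₀ : Finset Weight := posRoots.powerset.image (fun S => ∑ α ∈ S, α)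

/-- `Q_ϖ` for the dominant weight `ϖ = n ϖ₁ + m ϖ₂`. -/
def Qw (q : ℂ) (n m : ℕ) : ℂ :=
  if n = 0 ∧ m = 0 then (1 - q⁻¹ ^ 2) * (1 - q⁻¹ ^ 6) / (1 - q⁻¹) ^ 2
  else if n = 0 ∨ m = 0 then 1 + q⁻¹
  else 1

/-- The signed character attached to a weight `μ`, given the characters `χ a b` with highest weight
`a ϖ₁ + b ϖ₂`: it is `(-1)^{ℓ(w)} χ_{w μ - ρ}` if `μ` is regular and `w` is the unique element of
the Weyl group that makes `w μ` strictly dominant, and `0` if `μ` lies on a wall. The sign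
`(-1)^{ℓ(w)}` is the determinant of `w`. -/
def signedChar (χ : ℕ → ℕ → ℂ) (μ : Weight) : ℂ :=
  ∑ w ∈ weylGroup, if 0 < w.mulVec μ 0 ∧ 0 < w.mulVec μ 1 then
    (w.det : ℂ) * χ ((w.mulVec μ - rho) 0).toNat ((w.mulVec μ - rho) 1).toNat else 0

/-- `p(n,m) = Q_ϖ⁻¹ ∑_{ν ∈ S₀} P_ν(q⁻¹) (signed character of ϖ + ρ - ν)`, `ϖ = n ϖ₁ + m ϖ₂`. -/
def p (q : ℂ) (χ : ℕ → ℕ → ℂ) (n m : ℕ) : ℂ :=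
  (Qw q n m)⁻¹ * ∑ ν ∈ S₀, Polynomial.aeval q⁻¹ (P ν) * signedChar χ (![(n : ℤ), (m : ℤ)] + rho - ν)

/-! ### The polynomials `I₀` and `z₀` -/

/-- `I₀(n,m;x,q)`, in any commutative ring. -/
def I₀ {R : Type*} [CommRing R] (n m : ℕ) (x q : R) : R :=
  (1 - x * q ^ 6) * (1 - x ^ 3 * q ^ 21) - (1 - x * q ^ 5) * (1 - x * q ^ 6) * (x * q ^ 8) ^ (m + 1)
    - (1 - x * q ^ 8) * (1 - x * q ^ 5) * (x * q ^ 8) ^ m * (x * q ^ 7) ^ (n + 1)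

/-- `z₀(x,q)`, in any commutative ring. -/
def z₀ {R : Type*} [CommRing R] (x q : R) : R :=
  (1 - x * q ^ 5) * (1 - x * q ^ 6) * (1 - x * q ^ 7) * (1 - x * q ^ 8) * (1 - x ^ 2 * q ^ 14) *
    (1 - x ^ 3 * q ^ 21)

end

end G2Unramified

/-!
Both sides of the identity are linear in the characters `χ_λ`, and it holds coefficient by
coefficient. With `t = q⁻¹` and `u = x q⁸`, the sum `∑_ν P_ν(t) χ̃_{ϖ+ρ-ν}` arises from
`μ ↦ χ̃_μ` by applying the difference operators `1 - t T_{-α}` for all positive roots `α`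
(`sum_P_mul`). Moving these operators and the Weyl group sum in `χ̃` to the other factor, the
coefficient of `χ_λ` in the left-hand side is

  `∑_w det w · (∏_{α > 0} (1 - t T_α) H) (w (λ + ρ))`,

where `H` (`kern`) is the function `ϖ + ρ ↦ Q_ϖ⁻¹ I₀(n,m) x^(n+2m) q^(8n+15m)`, extended by zero to
the weights that are not strictly dominant; the coefficient is a finite sum (`dualSum`). It has to
equal `z₀ u^a` at `λ = a ϖ₁`, and zero at the other dominant weights.

Away from the walls `H` is a combination of three exponentials `r^n s^m`; the operator of `α₁` kills
the first of them and the operator of `α₂` the third. Near one wall only `1` and the corresponding simple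
reflection `sᵢ` contribute. The remaining positive roots are permuted by `sᵢ`, so one may
antisymmetrize `(1 - t T_{αᵢ}) H` under `sᵢ` first, and the values of `I₀` and `Q_ϖ` are such that
the result is an explicit function:
* for `s₁` it is a combination of two exponentials on all of the relevant region, and each of them
  is annihilated by the operator of one further root (`dualSum_of_four_le`);
* for `s₂` it is a combination of two exponentials on either side of the wall, again annihilated by
  two further operators, except that the break at the wall leaves the contribution `z₀ u^a` at the
  weights `a ϖ₁` (`dualSum_of_five_le`).
The fifteen weights close to both walls are computed directly (`dualSum_corner`). The identity of
coefficients is polynomial in `u`, so it holds in every `ℂ`-algebra (`dualSum_algebraMap`).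

Interchanging the sums needs only that, for each Weyl group element `w` and each set of positive
roots, the corresponding part of the sum converges (`exists_hasSum_identity`). For power series every
coefficient is a finite sum. For complex `x` the summation weight at `ϖ` is bounded by a constant
times its value `|u^a (u² t)^b|` at the weight `λ` of the character that occurs, because `λ` exceeds
`ϖ` by a bounded amount and `|u|, |u² t| ≤ 1` (`summable_complex`).
-/

namespace G2Unramified

/-! ### Difference operators on the weight lattice -/

section DiffSum

variable {R : Type*} [CommRing R]

/-- The operator `∏_{α ∈ A} (1 - t T_α)` on functions on the weight lattice, where
`T_α` is the translation `(T_α F)(μ) = F (μ + α)`, expanded over the subsets of `A`. -/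
def diffSum (t : R) (A : Finset Weight) (F : Weight → R) (μ : Weight) : R :=
  ∑ S ∈ A.powerset, (-t) ^ S.card * F (μ + ∑ α ∈ S, α)

theorem diffSum_empty (t : R) (F : Weight → R) (μ : Weight) : diffSum t ∅ F μ = F μ := by
  simp [diffSum]

theorem diffSum_insert (t : R) {A : Finset Weight} {α : Weight} (hα : α ∉ A) (F : Weight → R)
    (μ : Weight) :
    diffSum t (insert α A) F μ = diffSum t A F μ - t * diffSum t A F (μ + α) := by
  unfold diffSum
  rw [Finset.sum_powerset_insert hα, sub_eq_add_neg, ← neg_mul, Finset.mul_sum]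
  congr 1
  refine Finset.sum_congr rfl fun S hS => ?_
  have : α ∉ S := fun h => hα (Finset.mem_powerset.1 hS h)
  rw [Finset.card_insert_of_notMem this, Finset.sum_insert this, pow_succ', mul_assoc, add_assoc]

theorem diffSum_congr (t : R) {A : Finset Weight} {F G : Weight → R} {μ : Weight}
    (h : ∀ S ⊆ A, F (μ + ∑ α ∈ S, α) = G (μ + ∑ α ∈ S, α)) :
    diffSum t A F μ = diffSum t A G μ :=
  Finset.sum_congr rfl fun S hS => by rw [h S (Finset.mem_powerset.1 hS)]

theorem diffSum_sub (t : R) (A : Finset Weight) (F G : Weight → R) (μ : Weight) :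
    diffSum t A (fun ν => F ν - G ν) μ = diffSum t A F μ - diffSum t A G μ := by
  simp only [diffSum, mul_sub, Finset.sum_sub_distrib]

/-- The operator of one root may be applied to the function first. -/
theorem diffSum_insert' (t : R) {A : Finset Weight} {α : Weight} (hα : α ∉ A) (F : Weight → R)
    (μ : Weight) :
    diffSum t (insert α A) F μ = diffSum t A (fun ν => F ν - t * F (ν + α)) μ := by
  rw [diffSum_insert t hα, diffSum_sub]
  congr 1
  simp only [diffSum, Finset.mul_sum]
  refine Finset.sum_congr rfl fun S _ => ?_
  rw [add_right_comm]
  ring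

/-- The difference operators are equivariant under injective linear substitutions. -/
theorem diffSum_comp (t : R) (A : Finset Weight) (w : Weight →+ Weight)
    (hw : Function.Injective w) (F : Weight → R) (μ : Weight) :
    diffSum t A (fun ν => F (w ν)) μ = diffSum t (A.image w) F (w μ) := by
  induction A using Finset.induction_on generalizing μ with
  | empty => simp [diffSum_empty]
  | insert α A hα ih =>
    rw [diffSum_insert t hα, ih, ih, Finset.image_insert, diffSum_insert, map_add]
    simpa [hw.eq_iff] using hα

/-- A bound for an additive functional on the sums of distinct elements of `A`. -/
theorem sum_apply_le {A S : Finset Weight} (h : S ⊆ A) (f : Weight →+ ℤ) :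
    f (∑ α ∈ S, α) ≤ ∑ α ∈ A, max (f α) 0 := by
  rw [map_sum]
  exact (Finset.sum_le_sum fun _ _ => le_max_left _ _).trans
    (Finset.sum_le_sum_of_subset_of_nonneg h fun _ _ _ => le_max_right _ _)

/-- An exponential is an eigenfunction of the difference operators. -/
theorem diffSum_exp {K : Type*} [Field K] (t : K) (A : Finset Weight) {c r s : K}
    (hr : r ≠ 0) (hs : s ≠ 0) (μ : Weight) :
    diffSum t A (fun ν => c * (r ^ ν 0 * s ^ ν 1)) μ =
      c * (r ^ μ 0 * s ^ μ 1) * ∏ α ∈ A, (1 - t * (r ^ α 0 * s ^ α 1)) := by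
  induction A using Finset.induction_on generalizing μ with
  | empty => simp [diffSum_empty]
  | insert α A hα ih =>
    rw [diffSum_insert t hα, ih, ih, Finset.prod_insert hα]
    simp only [Pi.add_apply, zpow_add₀ hr, zpow_add₀ hs]
    ring

end DiffSum

/-! ### The summation weight and the coefficients of the characters -/

section Kernel

variable {R : Type*} [CommRing R]

/-- The coefficient of `Q_ϖ⁻¹`, in terms of inverses `y` of `1 + t` and
`z` of `(1 + t) (1 + t + ⋯ + t⁵)`. -/
def invQ (y z : R) (n m : ℕ) : R :=
  if n = 0 ∧ m = 0 then z else if n = 0 ∨ m = 0 then y else 1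

/-- The summation weight `I₀ x^(n+2m) q^(8n+15m)` in the variables `u = x q⁸` and `t = q⁻¹`. -/
def wt (u t : R) (n m : ℕ) : R :=
  ((1 - u * t ^ 2) * (1 - u ^ 3 * t ^ 3) - (1 - u * t ^ 3) * (1 - u * t ^ 2) * u ^ (m + 1)
    - (1 - u) * (1 - u * t ^ 3) * u ^ m * (u * t) ^ (n + 1)) * (u ^ n * (u ^ 2 * t) ^ m)

/-- The summation weight, divided by `Q_ϖ`, as a function of `ϖ + ρ`, extended by zero to the
weights that are not strictly dominant. -/
def kern (y z u t : R) (μ : Weight) : R :=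
  if 0 < μ 0 ∧ 0 < μ 1 then
    invQ y z (μ 0 - 1).toNat (μ 1 - 1).toNat * wt u t (μ 0 - 1).toNat (μ 1 - 1).toNat
  else 0

theorem kern_of_not (y z u t : R) {μ : Weight} (h : μ 0 ≤ 0 ∨ μ 1 ≤ 0) : kern y z u t μ = 0 :=
  if_neg (by omega)

theorem kern_succ (y z u t : R) (n m : ℕ) :
    kern y z u t ![(n : ℤ) + 1, (m : ℤ) + 1] = invQ y z n m * wt u t n m := by
  have h (k : ℕ) : (0 : ℤ) < k + 1 := by omega
  simp [kern, h]

theorem map_kern {R' : Type*} [CommRing R'] (f : R →+* R') (y z u t : R) (μ : Weight) :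
    f (kern y z u t μ) = kern (f y) (f z) (f u) (f t) μ := by
  simp only [kern, invQ, wt, apply_ite f, map_mul, map_sub, map_pow, map_one, map_zero]

/-- The polynomial `z₀` in the variables `u = x q⁸` and `t = q⁻¹`. -/
def zt (u t : R) : R :=
  (1 - u * t ^ 3) * (1 - u * t ^ 2) * (1 - u * t) * (1 - u) * (1 - u ^ 2 * t ^ 2) *
    (1 - u ^ 3 * t ^ 3)

/-- The transposed kernel: the coefficient of the character with highest weight `λ = μ - ρ` in the
left-hand side. -/
def dualSum (y z u t : R) (μ : Weight) : R :=
  ∑ w ∈ weylGroup, (w.det : R) * diffSum t posRoots (kern y z u t) (w.mulVec μ)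

end Kernel

theorem weylGroup_eq : weylGroup = {1, s₁, s₂, !![2, 3; -1, -1], !![-1, -3; 1, 2],
    !![-2, -3; 1, 2], !![2, 3; -1, -2], !![-2, -3; 1, 1], !![1, 3; -1, -2], !![-1, -3; 0, 1],
    !![1, 0; -1, -1], -1} := by
  decide

theorem sum_weylGroup {M : Type*} [AddCommMonoid M] (f : Matrix (Fin 2) (Fin 2) ℤ → M) :
    ∑ w ∈ weylGroup, f w =
      f 1 + f s₁ + f s₂ + f !![2, 3; -1, -1] + f !![-1, -3; 1, 2] + f !![-2, -3; 1, 2]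
        + f !![2, 3; -1, -2] + f !![-2, -3; 1, 1] + f !![1, 3; -1, -2] + f !![-1, -3; 0, 1]
        + f !![1, 0; -1, -1] + f (-1) := by
  rw [weylGroup_eq]
  repeat rw [Finset.sum_insert (by decide)]
  rw [Finset.sum_singleton]
  simp only [add_assoc]

section Dual

variable {R : Type*} [CommRing R]

theorem dualSum_eq (y z u t : R) (i j : ℤ) :
    dualSum y z u t ![i, j] =
      diffSum t posRoots (kern y z u t) ![i, j]
      - diffSum t posRoots (kern y z u t) ![-i, i + j]
      - diffSum t posRoots (kern y z u t) ![i + 3 * j, -j]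
      + diffSum t posRoots (kern y z u t) ![2 * i + 3 * j, -i - j]
      + diffSum t posRoots (kern y z u t) ![-i - 3 * j, i + 2 * j]
      - diffSum t posRoots (kern y z u t) ![-2 * i - 3 * j, i + 2 * j]
      - diffSum t posRoots (kern y z u t) ![2 * i + 3 * j, -i - 2 * j]
      + diffSum t posRoots (kern y z u t) ![-2 * i - 3 * j, i + j]
      + diffSum t posRoots (kern y z u t) ![i + 3 * j, -i - 2 * j]
      - diffSum t posRoots (kern y z u t) ![-i - 3 * j, j]
      - diffSum t posRoots (kern y z u t) ![i, -i - j]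
      + diffSum t posRoots (kern y z u t) ![-i, -j] := by
  rw [dualSum, sum_weylGroup]
  have hv (a b c d : ℤ) : (!![a, b; c, d] : Matrix (Fin 2) (Fin 2) ℤ).mulVec ![i, j] =
      ![a * i + b * j, c * i + d * j] := by
    ext k; fin_cases k <;> simp [Matrix.mulVec, dotProduct]
  have h1 : (1 : Matrix (Fin 2) (Fin 2) ℤ) = !![1, 0; 0, 1] := by decide
  have h2 : (-1 : Matrix (Fin 2) (Fin 2) ℤ) = !![-1, 0; 0, -1] := by decide
  rw [h2, h1, s₁, s₂]
  simp only [hv, Matrix.det_fin_two_of]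
  norm_num
  ring_nf

/-- A sum of distinct positive roots has coordinates at most `6` and `4`, so the difference operators
do not carry the support of `kern` further than that. -/
theorem diffSum_kern_eq_zero (y z u t : R) {μ : Weight} (h : μ 0 ≤ -6 ∨ μ 1 ≤ -4) :
    diffSum t posRoots (kern y z u t) μ = 0 := by
  refine Finset.sum_eq_zero fun S hS => ?_
  have h0 := sum_apply_le (Finset.mem_powerset.1 hS) (Pi.evalAddMonoidHom (fun _ => ℤ) 0)
  have h1 := sum_apply_le (Finset.mem_powerset.1 hS) (Pi.evalAddMonoidHom (fun _ => ℤ) 1)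
  have e0 : ∑ α ∈ posRoots, max (α 0) 0 = 6 := by decide
  have e1 : ∑ α ∈ posRoots, max (α 1) 0 = 4 := by decide
  simp only [Pi.evalAddMonoidHom_apply, e0, e1] at h0 h1
  rw [kern_of_not, mul_zero]
  simp only [Pi.add_apply]
  omega

/-- Far from the wall of `α₂` only `1` and `s₁` contribute. -/
theorem dualSum_eq_s₁ (y z u t : R) {i j : ℤ} (hi : 0 < i) (hj : 4 ≤ j) :
    dualSum y z u t ![i, j] = diffSum t posRoots (kern y z u t) ![i, j]
      - diffSum t posRoots (kern y z u t) ![-i, i + j] := by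
  rw [dualSum_eq]
  have e (a b : ℤ) (h : a ≤ -6 ∨ b ≤ -4) : diffSum t posRoots (kern y z u t) ![a, b] = 0 :=
    diffSum_kern_eq_zero y z u t h
  simp (disch := omega) only [e]
  ring

/-- Far from the wall of `α₁` only `1` and `s₂` contribute. -/
theorem dualSum_eq_s₂ (y z u t : R) {i j : ℤ} (hi : 6 ≤ i) (hj : 0 < j) :
    dualSum y z u t ![i, j] = diffSum t posRoots (kern y z u t) ![i, j]
      - diffSum t posRoots (kern y z u t) ![i + 3 * j, -j] := by
  rw [dualSum_eq]
  have e (a b : ℤ) (h : a ≤ -6 ∨ b ≤ -4) : diffSum t posRoots (kern y z u t) ![a, b] = 0 :=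
    diffSum_kern_eq_zero y z u t h
  simp (disch := omega) only [e]
  ring

/-- The linear action of a Weyl group element, as an additive map. -/
def act (w : Matrix (Fin 2) (Fin 2) ℤ) : Weight →+ Weight := w.mulVecLin.toAddMonoidHom

theorem act_apply (w : Matrix (Fin 2) (Fin 2) ℤ) (μ : Weight) : act w μ = w.mulVec μ := rfl

theorem act_s₁ (i j : ℤ) : act s₁ ![i, j] = ![-i, i + j] := by
  ext k; fin_cases k <;> simp [act_apply, s₁, Matrix.mulVec, dotProduct]

theorem act_s₂ (i j : ℤ) : act s₂ ![i, j] = ![i + 3 * j, -j] := by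
  ext k; fin_cases k <;> simp [act_apply, s₂, Matrix.mulVec, dotProduct]

theorem eta_weight (μ : Weight) : ![μ 0, μ 1] = μ := by
  ext k; fin_cases k <;> rfl

theorem act_injective {w : Matrix (Fin 2) (Fin 2) ℤ} (h : w * w = 1) :
    Function.Injective (act w) :=
  Function.LeftInverse.injective (g := act w) fun μ => by
    rw [act_apply, act_apply, Matrix.mulVec_mulVec, h, Matrix.one_mulVec]

/-- Antisymmetrization under a simple reflection `w` reduces the product over all positive roots
to the product over the positive roots permuted by `w`. -/
theorem diffSum_sub_act (t : R) {A : Finset Weight} {α : Weight} (hα : α ∉ A)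
    {w : Matrix (Fin 2) (Fin 2) ℤ} (hw : w * w = 1) (hA : A.image (act w) = A)
    (F : Weight → R) (μ : Weight) :
    diffSum t (insert α A) F μ - diffSum t (insert α A) F (act w μ) =
      diffSum t A (fun ν => (F ν - t * F (ν + α)) - (F (act w ν) - t * F (act w ν + α))) μ := by
  rw [diffSum_insert' t hα, diffSum_insert' t hα,
    diffSum_sub t A (fun ν => F ν - t * F (ν + α)) (fun ν => F (act w ν) - t * F (act w ν + α)),
    diffSum_comp t A (act w) (act_injective hw) (fun ν => F ν - t * F (ν + α)), hA]

end Dual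

/-! ### The wall of the short root -/

section Alpha₁

variable {K : Type*} [Field K] {y z u t : K}

/-- The antisymmetrization under `s₁` of `1 - t T_{α₁}` applied to the summation weight, away from
the wall of `α₂`: the exponential `u^i (u² t)^j` disappears, and the other two, which are exchanged
by `s₁`, combine into an antisymmetric function valid for `i` of any sign. -/
theorem kern_antisymm_s₁ (hu : u ≠ 0) (ht : t ≠ 0) (hy : y * (1 + t) = 1) {i j : ℤ}
    (hj : 3 ≤ j) (hij : 3 ≤ i + j) :
    (kern y z u t ![i, j] - t * kern y z u t ![i + 2, j - 1])
        - (kern y z u t ![-i, i + j] - t * kern y z u t ![-i + 2, i + j - 1]) =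
      (1 - u * t ^ 3) * (1 - u * t ^ 2) * (1 - u) * (u ^ 4 * t)⁻¹ *
        (u ^ i * (u ^ 3 * t) ^ j - (u ^ 2 * t) ^ i * (u ^ 3 * t) ^ j) := by
  have pos : ∀ i j : ℤ, 0 < i → 3 ≤ j →
      (kern y z u t ![i, j] - t * kern y z u t ![i + 2, j - 1])
        - (kern y z u t ![-i, i + j] - t * kern y z u t ![-i + 2, i + j - 1]) =
      (1 - u * t ^ 3) * (1 - u * t ^ 2) * (1 - u) * (u ^ 4 * t)⁻¹ *
        (u ^ i * (u ^ 3 * t) ^ j - (u ^ 2 * t) ^ i * (u ^ 3 * t) ^ j) := by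
    intro i j hi hj
    obtain ⟨n, rfl⟩ : ∃ n : ℕ, i = n + 1 := ⟨(i - 1).toNat, by omega⟩
    obtain ⟨m, rfl⟩ : ∃ m : ℕ, j = m + 1 + 1 + 1 := ⟨(j - 3).toNat, by omega⟩
    have e1 := kern_succ y z u t n (m + 2)
    have e2 := kern_succ y z u t (n + 2) (m + 1)
    have e3 : kern y z u t ![-((n : ℤ) + 1), (n : ℤ) + 1 + (m + 1 + 1 + 1)] = 0 :=
      kern_of_not _ _ _ _ (by simp)
    have e4 : kern y z u t ![-((n : ℤ) + 1) + 2, (n : ℤ) + 1 + (m + 1 + 1 + 1) - 1] =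
        if n = 0 then y * wt u t 0 (m + 2) else 0 := by
      rcases n with _ | n
      · have := kern_succ y z u t 0 (m + 2)
        simp only [invQ] at this
        push_cast at this ⊢
        simp at this ⊢
        rw [← this]; ring_nf
      · rw [if_neg (by omega)]
        exact kern_of_not _ _ _ _ (by simp; omega)
    rw [e3, e4]
    rw [show ((n : ℤ) + 1 + 2) = ((n + 2 : ℕ) : ℤ) + 1 by push_cast; ring,
      show ((m : ℤ) + 1 + 1 + 1 - 1) = ((m + 1 : ℕ) : ℤ) + 1 by push_cast; ring,
      show ((m : ℤ) + 1 + 1 + 1) = ((m + 2 : ℕ) : ℤ) + 1 by push_cast; ring, e1, e2]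
    -- the exponential `u^i (u² t)^j` is killed because `t u² = u² t`
    have key : (wt u t n (m + 2) - t * wt u t (n + 2) (m + 1)) * (u ^ 4 * t) =
      (1 - u * t ^ 3) * (1 - u * t ^ 2) * (1 - u) *
        (u ^ (n + 1) * (u ^ 3 * t) ^ (m + 3) - (u ^ 2 * t) ^ (n + 1) * (u ^ 3 * t) ^ (m + 3)) := by
      simp only [wt]; ring
    have key' : (1 - u * t ^ 3) * (1 - u * t ^ 2) * (1 - u) * (u ^ 4 * t)⁻¹ *
        (u ^ ((n : ℤ) + 1) * (u ^ 3 * t) ^ (((m + 2 : ℕ) : ℤ) + 1)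
          - (u ^ 2 * t) ^ ((n : ℤ) + 1) * (u ^ 3 * t) ^ (((m + 2 : ℕ) : ℤ) + 1)) =
        wt u t n (m + 2) - t * wt u t (n + 2) (m + 1) := by
      rw [eq_comm, ← mul_right_inj' (mul_ne_zero (pow_ne_zero 4 hu) ht), mul_comm, key]
      norm_cast
      field_simp
    rw [key']
    -- at `n = 0` the two terms in `y` add up to `y (1 + t) = 1`
    rcases n with _ | n
    · simp only [invQ]
      simp
      linear_combination (wt u t 0 (m + 2)) * hy
    · simp [invQ]
  -- both sides are antisymmetric under `s₁`, which exchanges `u` and `u² t` and fixes `u³ t`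
  rcases lt_trichotomy i 0 with h | rfl | h
  · have := pos (-i) (i + j) (by omega) hij
    rw [show -i + (i + j) = j by ring, neg_neg] at this
    rw [← neg_sub, this]
    have h2 : u ^ (-i) * (u ^ 3 * t) ^ (i + j) = (u ^ 2 * t) ^ i * (u ^ 3 * t) ^ j := by
      rw [zpow_add₀ (by simp [hu, ht]), show u ^ 3 * t = u * (u ^ 2 * t) by ring, mul_zpow u _ i,
        zpow_neg]
      field_simp
    have h3 : (u ^ 2 * t) ^ (-i) * (u ^ 3 * t) ^ (i + j) = u ^ i * (u ^ 3 * t) ^ j := by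
      rw [zpow_add₀ (by simp [hu, ht]), show u ^ 3 * t = u * (u ^ 2 * t) by ring, mul_zpow u _ i,
        zpow_neg]
      field_simp
    rw [h2, h3]; ring
  · simp
  · exact pos i j h hj

/-- The coefficient vanishes far from the wall of `α₂`. -/
theorem dualSum_of_four_le (hu : u ≠ 0) (ht : t ≠ 0) (hy : y * (1 + t) = 1) {i j : ℤ}
    (hi : 0 < i) (hj : 4 ≤ j) : dualSum y z u t ![i, j] = 0 := by
  set A : Finset Weight := {![-3, 2], ![-1, 1], ![1, 0], ![3, -1], ![0, 1]} with hA
  have hR : posRoots = insert ![2, -1] A := rfl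
  rw [dualSum_eq_s₁ y z u t hi hj, hR, ← act_s₁,
    diffSum_sub_act t (by decide) (by decide) (by decide)]
  set c := (1 - u * t ^ 3) * (1 - u * t ^ 2) * (1 - u) * (u ^ 4 * t)⁻¹
  have h1 : diffSum t A (fun ν => (kern y z u t ν - t * kern y z u t (ν + ![2, -1]))
        - (kern y z u t (act s₁ ν) - t * kern y z u t (act s₁ ν + ![2, -1]))) ![i, j] =
      diffSum t A (fun ν => c * (u ^ ν 0 * (u ^ 3 * t) ^ ν 1)
        - c * ((u ^ 2 * t) ^ ν 0 * (u ^ 3 * t) ^ ν 1)) ![i, j] := by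
    refine diffSum_congr t fun S hS => ?_
    have h0 := sum_apply_le hS (-Pi.evalAddMonoidHom (fun _ => ℤ) 1)
    have h1 := sum_apply_le hS (-Pi.evalAddMonoidHom (fun _ => ℤ) 0
      - Pi.evalAddMonoidHom (fun _ => ℤ) 1)
    have e0 : ∑ α ∈ A, max (-α 1) 0 = 1 := by decide
    have e1 : ∑ α ∈ A, max (-α 0 - α 1) 0 = 1 := by decide
    simp only [AddMonoidHom.neg_apply, AddMonoidHom.sub_apply, Pi.evalAddMonoidHom_apply, e0, e1]
      at h0 h1
    generalize (∑ α ∈ S, α) = s at h0 h1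
    have := kern_antisymm_s₁ (z := z) hu ht hy (i := i + s 0) (j := j + s 1) (by omega) (by omega)
    rw [← eta_weight s]
    simp only [Matrix.add_cons, Matrix.head_cons, Matrix.tail_cons, Matrix.empty_add_empty, act_s₁,
      Matrix.cons_val_zero, Matrix.cons_val_one]
    rw [← mul_sub]
    exact this
  have hu3 : u ^ 3 * t ≠ 0 := by simp [hu, ht]
  -- the roots `3α₁+α₂` and `α₂` annihilate the two exponentials
  rw [h1, diffSum_sub, diffSum_exp t A hu hu3, diffSum_exp t A (by simp [hu, ht]) hu3,
    Finset.prod_eq_zero (i := ![3, -1]) (by decide), Finset.prod_eq_zero (i := ![-3, 2]) (by decide)]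
  · simp
  · simp; field_simp; simp
  · simp; field_simp; simp

end Alpha₁

/-! ### The wall of the long root -/

section Alpha₂

variable {K : Type*} [Field K] {y z u t : K}

/-- The antisymmetrization under `s₂` of `1 - t T_{α₂}` applied to the summation weight, away from
the wall of `α₁`, on the dominant side of the wall of `α₂`. The exponential
`(u² t)^i (u³ t)^j` disappears. -/
theorem kern_antisymm_s₂ (hu : u ≠ 0) (ht : t ≠ 0) (hy : y * (1 + t) = 1) {i j : ℤ}
    (hi : 5 ≤ i) (hj : 0 ≤ j) :
    (kern y z u t ![i, j] - t * kern y z u t ![i - 3, j + 2])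
        - (kern y z u t ![i + 3 * j, -j] - t * kern y z u t ![i + 3 * j - 3, -j + 2]) =
      (1 - u * t ^ 3) * (1 - u * t ^ 2) * (1 - u ^ 3 * t ^ 3) * (u ^ 3 * t)⁻¹ *
        (u ^ i * (u ^ 2 * t) ^ j - u ^ i * (u ^ 3 * t) ^ j) := by
  rcases hj.eq_or_lt with rfl | hj
  · simp
  obtain ⟨n, rfl⟩ : ∃ n : ℕ, i = n + 1 + 1 + 1 + 1 + 1 := ⟨(i - 5).toNat, by omega⟩
  obtain ⟨m, rfl⟩ : ∃ m : ℕ, j = m + 1 := ⟨(j - 1).toNat, by omega⟩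
  have e1 := kern_succ y z u t (n + 4) m
  have e2 := kern_succ y z u t (n + 1) (m + 2)
  have e3 : kern y z u t ![(n : ℤ) + 1 + 1 + 1 + 1 + 1 + 3 * (m + 1), -((m : ℤ) + 1)] = 0 :=
    kern_of_not _ _ _ _ (Or.inr (by simp only [Matrix.cons_val_one, Matrix.cons_val_zero]; omega))
  have e4 : kern y z u t ![(n : ℤ) + 1 + 1 + 1 + 1 + 1 + 3 * (m + 1) - 3, -((m : ℤ) + 1) + 2] =
      if m = 0 then y * wt u t (n + 4) 0 else 0 := by
    rcases m with _ | m
    · have := kern_succ y z u t (n + 4) 0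
      simp only [invQ] at this
      push_cast at this ⊢
      simp at this ⊢
      rw [← this]; ring_nf
    · rw [if_neg (by omega)]
      exact kern_of_not _ _ _ _
        (Or.inr (by simp only [Matrix.cons_val_one, Matrix.cons_val_zero]; push_cast; omega))
  rw [e3, e4]
  rw [show ((n : ℤ) + 1 + 1 + 1 + 1 + 1 - 3) = ((n + 1 : ℕ) : ℤ) + 1 by push_cast; ring,
    show ((n : ℤ) + 1 + 1 + 1 + 1 + 1) = ((n + 4 : ℕ) : ℤ) + 1 by push_cast; ring,
    show ((m : ℤ) + 1 + 2) = ((m + 2 : ℕ) : ℤ) + 1 by push_cast; ring, e1, e2]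
  -- the exponential `(u² t)^i (u³ t)^j` is killed because `t (u³ t)² = (u² t)³`
  have key : (wt u t (n + 4) m - t * wt u t (n + 1) (m + 2)) * (u ^ 3 * t) =
    (1 - u * t ^ 3) * (1 - u * t ^ 2) * (1 - u ^ 3 * t ^ 3) *
      (u ^ (n + 5) * (u ^ 2 * t) ^ (m + 1) - u ^ (n + 5) * (u ^ 3 * t) ^ (m + 1)) := by
    simp only [wt]; ring
  have key' : (1 - u * t ^ 3) * (1 - u * t ^ 2) * (1 - u ^ 3 * t ^ 3) * (u ^ 3 * t)⁻¹ *
      (u ^ (((n + 4 : ℕ) : ℤ) + 1) * (u ^ 2 * t) ^ ((m : ℤ) + 1)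
        - u ^ (((n + 4 : ℕ) : ℤ) + 1) * (u ^ 3 * t) ^ ((m : ℤ) + 1)) =
      wt u t (n + 4) m - t * wt u t (n + 1) (m + 2) := by
    rw [eq_comm, ← mul_right_inj' (mul_ne_zero (pow_ne_zero 3 hu) ht), mul_comm, key]
    norm_cast
    field_simp
  rw [key']
  -- at `m = 0` the two terms in `y` add up to `y (1 + t) = 1`
  rcases m with _ | m
  · simp only [invQ]
    simp
    linear_combination (wt u t (n + 4) 0) * hy
  · simp [invQ]

/-- Far from the wall of `α₁` only the coefficients of the characters with highest weight
`a ϖ₁` survive. -/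
theorem dualSum_of_five_le (hu : u ≠ 0) (ht : t ≠ 0) (hy : y * (1 + t) = 1) {a b : ℕ}
    (ha : 5 ≤ a) :
    dualSum y z u t ![(a : ℤ) + 1, (b : ℤ) + 1] = if b = 0 then zt u t * u ^ a else 0 := by
  set A : Finset Weight := {![2, -1], ![3, -1], ![-1, 1], ![1, 0], ![0, 1]} with hA
  have hR : posRoots = insert ![-3, 2] A := by decide
  rw [dualSum_eq_s₂ y z u t (by omega) (by omega), hR, ← act_s₂,
    diffSum_sub_act t (by decide) (by decide) (by decide)]
  set c := (1 - u * t ^ 3) * (1 - u * t ^ 2) * (1 - u ^ 3 * t ^ 3) * (u ^ 3 * t)⁻¹ with hc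
  -- `f` is the antisymmetrized kernel above the wall, `r` the error it makes below the wall
  set f : Weight → K := fun ν =>
    c * (u ^ ν 0 * (u ^ 2 * t) ^ ν 1) - c * (u ^ ν 0 * (u ^ 3 * t) ^ ν 1) with hf
  set r : Weight → K := fun ν => if 0 ≤ ν 1 then 0 else f (act s₂ ν) + f ν with hr
  have h1 : diffSum t A (fun ν => (kern y z u t ν - t * kern y z u t (ν + ![-3, 2]))
        - (kern y z u t (act s₂ ν) - t * kern y z u t (act s₂ ν + ![-3, 2])))
        ![(a : ℤ) + 1, (b : ℤ) + 1] =
      diffSum t A (fun ν => f ν - r ν) ![(a : ℤ) + 1, (b : ℤ) + 1] := by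
    refine diffSum_congr t fun S hS => ?_
    have h0 := sum_apply_le hS (-Pi.evalAddMonoidHom (fun _ => ℤ) 0)
    have h1 := sum_apply_le hS (-Pi.evalAddMonoidHom (fun _ => ℤ) 0
      - 3 • Pi.evalAddMonoidHom (fun _ => ℤ) 1)
    have e0 : ∑ α ∈ A, max (-α 0) 0 = 1 := by decide
    have e1 : ∑ α ∈ A, max (-α 0 - 3 * α 1) 0 = 1 := by decide
    simp only [AddMonoidHom.neg_apply, AddMonoidHom.sub_apply, AddMonoidHom.smul_apply,
      Pi.evalAddMonoidHom_apply, nsmul_eq_mul, Nat.cast_ofNat, e0, e1] at h0 h1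
    generalize (∑ α ∈ S, α) = s at h0 h1
    rw [← eta_weight s]
    simp only [Matrix.add_cons, Matrix.head_cons, Matrix.tail_cons, Matrix.empty_add_empty, act_s₂,
      hr, hf, Matrix.cons_val_zero, Matrix.cons_val_one, ← mul_sub]
    generalize hi : (a : ℤ) + 1 + s 0 = i
    generalize hj : (b : ℤ) + 1 + s 1 = j
    split_ifs with h
    · rw [sub_zero]
      have := kern_antisymm_s₂ (z := z) hu ht hy (i := i) (by omega) h
      rw [← mul_sub] at this
      exact this
    · have := kern_antisymm_s₂ (z := z) hu ht hy (i := i + 3 * j) (j := -j)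
        (by omega) (by omega)
      rw [show i + 3 * j + 3 * -j = i by ring, neg_neg] at this
      rw [← neg_sub]
      refine (congrArg Neg.neg this).trans ?_
      ring
  have hu2 : u ^ 2 * t ≠ 0 := by simp [hu, ht]
  have hu3 : u ^ 3 * t ≠ 0 := by simp [hu, ht]
  -- the roots `α₁` and `3α₁+α₂` annihilate the two exponentials, so only `r` contributes
  rw [h1, diffSum_sub, hf, diffSum_sub, diffSum_exp t A hu hu2, diffSum_exp t A hu hu3,
    Finset.prod_eq_zero (i := ![2, -1]) (by decide), Finset.prod_eq_zero (i := ![3, -1]) (by decide)]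
  · rcases b with _ | b
    · -- a translate of `(a+1, 1)` is below the wall only for `{α₁, 3α₁+α₂}` and
      -- `{α₁, 3α₁+α₂, 2α₁+α₂}`
      have hz (i j : ℤ) (h : 0 ≤ j) : r ![i, j] = 0 := if_pos h
      have hneg (i : ℤ) : r ![i, -1] = f ![i - 3, 1] + f ![i, -1] := by
        simp only [hr, act_s₂]
        simp [sub_eq_add_neg]
      have e : (![(a : ℤ) + 1, ((0 : ℕ) : ℤ) + 1] : Weight) = ![(a : ℤ) + 1, 1] := by simp
      rw [e, hA]
      repeat rw [diffSum_insert _ (by decide)]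
      rw [← insert_empty_eq]
      repeat rw [diffSum_insert _ (by simp)]
      simp only [diffSum_empty, Matrix.add_cons, Matrix.head_cons, Matrix.tail_cons,
        Matrix.empty_add_empty]
      norm_num [hz, hneg]
      rw [show (a : ℤ) + 1 + 2 + 3 + 1 - 3 = ((a + 4 : ℕ) : ℤ) by push_cast; ring,
        show (a : ℤ) + 1 + 2 + 3 + 1 = ((a + 7 : ℕ) : ℤ) by push_cast; ring,
        show (a : ℤ) + 1 + 2 + 3 = ((a + 6 : ℕ) : ℤ) by push_cast; ring,
        show (a : ℤ) + 1 + 2 = ((a + 3 : ℕ) : ℤ) by push_cast; ring]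
      simp only [hf, hc, zt, Matrix.cons_val_zero, Matrix.cons_val_one, zpow_natCast, zpow_one,
        zpow_neg]
      field_simp
      ring
    · have hz (i j : ℤ) (h : 0 ≤ j) : r ![i, j] = 0 := if_pos h
      rw [if_neg (by omega)]
      simp only [mul_zero, sub_self, zero_sub, neg_eq_zero]
      refine Finset.sum_eq_zero fun S hS => ?_
      have h0 := sum_apply_le (Finset.mem_powerset.1 hS) (-Pi.evalAddMonoidHom (fun _ => ℤ) 1)
      have e0 : ∑ α ∈ A, max (-α 1) 0 = 2 := by decide
      simp only [AddMonoidHom.neg_apply, Pi.evalAddMonoidHom_apply, e0] at h0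
      rw [← eta_weight (_ + _), hz, mul_zero]
      simp only [Pi.add_apply, Matrix.cons_val_one, Matrix.cons_val_zero]
      push_cast
      omega
  · simp; field_simp; simp
  · simp; field_simp; simp

end Alpha₂

/-- The operator of all positive roots, collected over the weights in `S₀`. -/
theorem diffSum_posRoots {R : Type*} [CommRing R] (t : R) (F : Weight → R) (i j : ℤ) :
    diffSum t posRoots F ![i, j] =
      (t ^ 2) * F ![i - 4, j + 3] + (-t ^ 3) * F ![i - 4, j + 4] + (-t) * F ![i - 3, j + 2]
        + (t ^ 2 - t ^ 3) * F ![i - 3, j + 3] + (t ^ 4) * F ![i - 3, j + 4]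
        + (t ^ 2 - t ^ 3) * F ![i - 2, j + 2] + (-t ^ 3 + t ^ 4) * F ![i - 2, j + 3]
        + (-t + t ^ 2) * F ![i - 1, j + 1] + (t ^ 2 - 2 * t ^ 3 + t ^ 4) * F ![i - 1, j + 2]
        + (t ^ 4 - t ^ 5) * F ![i - 1, j + 3] + (1) * F ![i, j]
        + (-t + 2 * t ^ 2 - t ^ 3) * F ![i, j + 1] + (-2 * t ^ 3 + 2 * t ^ 4) * F ![i, j + 2]
        + (-t ^ 5) * F ![i, j + 3] + (-t + t ^ 2) * F ![i + 1, j]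
        + (t ^ 2 - 2 * t ^ 3 + t ^ 4) * F ![i + 1, j + 1] + (t ^ 4 - t ^ 5) * F ![i + 1, j + 2]
        + (-t) * F ![i + 2, j - 1] + (2 * t ^ 2 - 2 * t ^ 3) * F ![i + 2, j]
        + (-t ^ 3 + 2 * t ^ 4 - t ^ 5) * F ![i + 2, j + 1] + (t ^ 6) * F ![i + 2, j + 2]
        + (-t + t ^ 2) * F ![i + 3, j - 1] + (t ^ 2 - 2 * t ^ 3 + t ^ 4) * F ![i + 3, j]
        + (t ^ 4 - t ^ 5) * F ![i + 3, j + 1] + (t ^ 2 - t ^ 3) * F ![i + 4, j - 1]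
        + (-t ^ 3 + t ^ 4) * F ![i + 4, j] + (t ^ 2) * F ![i + 5, j - 2]
        + (-t ^ 3 + t ^ 4) * F ![i + 5, j - 1] + (-t ^ 5) * F ![i + 5, j]
        + (-t ^ 3) * F ![i + 6, j - 2] + (t ^ 4) * F ![i + 6, j - 1] := by
  have hR : posRoots = insert ![2, -1] (insert ![-3, 2] (insert ![-1, 1] (insert ![1, 0]
    (insert ![3, -1] (insert ![0, 1] ∅))))) := by decide
  rw [hR]
  repeat rw [diffSum_insert _ (by decide)]
  simp only [diffSum_empty, Matrix.add_cons, Matrix.head_cons, Matrix.tail_cons,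
    Matrix.empty_add_empty, add_assoc, sub_eq_add_neg]
  norm_num
  ring

/-! ### Evaluation of all coefficients -/

section Field

variable {K : Type*} [Field K] {y z u t : K}

set_option maxHeartbeats 4000000 in
/-- The finitely many coefficients close to both walls are evaluated directly. -/
theorem dualSum_corner (hy : y * (1 + t) = 1)
    (hz : z * ((1 + t) * (1 + t + t ^ 2 + t ^ 3 + t ^ 4 + t ^ 5)) = 1) {a b : ℕ}
    (ha : a < 5) (hb : b < 3) :
    dualSum y z u t ![(a : ℤ) + 1, (b : ℤ) + 1] = if b = 0 then zt u t * u ^ a else 0 := by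
  have h1 : 1 + t ≠ 0 := right_ne_zero_of_mul_eq_one hy
  have h2 := right_ne_zero_of_mul_eq_one hz
  have h3 : 1 + t + t ^ 2 + t ^ 3 + t ^ 4 + t ^ 5 ≠ 0 := right_ne_zero_of_mul h2
  have hy' : y = (1 + t)⁻¹ := eq_inv_of_mul_eq_one_left hy
  have hz' : z = _ := eq_inv_of_mul_eq_one_left hz
  have e (a b : ℤ) (h : a ≤ -6 ∨ b ≤ -4) : diffSum t posRoots (kern y z u t) ![a, b] = 0 :=
    diffSum_kern_eq_zero y z u t h
  rw [dualSum_eq]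
  interval_cases a <;> interval_cases b <;>
  · simp (disch := omega) only [e]
    simp only [diffSum_posRoots]
    norm_num [kern, invQ, Int.reduceToNat]
    simp only [Int.reduceToNat, wt, zt, hy', hz']
    field_simp
    ring

theorem dualSum_of_ne_zero (hu : u ≠ 0) (ht : t ≠ 0) (hy : y * (1 + t) = 1)
    (hz : z * ((1 + t) * (1 + t + t ^ 2 + t ^ 3 + t ^ 4 + t ^ 5)) = 1) (a b : ℕ) :
    dualSum y z u t ![(a : ℤ) + 1, (b : ℤ) + 1] = if b = 0 then zt u t * u ^ a else 0 := by
  rcases le_or_gt 5 a with ha | ha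
  · exact dualSum_of_five_le hu ht hy ha
  rcases lt_or_ge b 3 with hb | hb
  · exact dualSum_corner hy hz ha hb
  · rw [dualSum_of_four_le hu ht hy (by omega) (by omega), if_neg (by omega)]

end Field

theorem map_dualSum {R R' : Type*} [CommRing R] [CommRing R'] (f : R →+* R') (y z u t : R)
    (μ : Weight) : f (dualSum y z u t μ) = dualSum (f y) (f z) (f u) (f t) μ := by
  simp only [dualSum, diffSum, map_sum, map_mul, map_pow, map_neg, map_kern, map_intCast]

theorem map_zt {R R' : Type*} [CommRing R] [CommRing R'] (f : R →+* R') (u t : R) :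
    f (zt u t) = zt (f u) (f t) := by
  simp only [zt, map_mul, map_sub, map_pow, map_one]

/-- The evaluation of the coefficients over any algebra and without restriction on `u`: the
identity is polynomial in `u`, so it may be checked in the field of rational functions. -/
theorem dualSum_algebraMap {k R : Type*} [Field k] [CommRing R] [Algebra k R] {y z t : k}
    (ht : t ≠ 0) (hy : y * (1 + t) = 1)
    (hz : z * ((1 + t) * (1 + t + t ^ 2 + t ^ 3 + t ^ 4 + t ^ 5)) = 1) (u : R) (a b : ℕ) :
    dualSum (algebraMap k R y) (algebraMap k R z) u (algebraMap k R t)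
      ![(a : ℤ) + 1, (b : ℤ) + 1] =
      if b = 0 then zt u (algebraMap k R t) * u ^ a else 0 := by
  have h : dualSum (Polynomial.C y) (Polynomial.C z) Polynomial.X (Polynomial.C t)
      ![(a : ℤ) + 1, (b : ℤ) + 1] =
      if b = 0 then zt Polynomial.X (Polynomial.C t) * Polynomial.X ^ a else 0 := by
    apply IsFractionRing.injective (Polynomial k) (FractionRing (Polynomial k))
    set f := algebraMap (Polynomial k) (FractionRing (Polynomial k))
    have hf (P : Polynomial k) (hP : P ≠ 0) : f P ≠ 0 :=
      (map_ne_zero_iff f (IsFractionRing.injective _ _)).2 hP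
    rw [map_dualSum, dualSum_of_ne_zero (hf _ Polynomial.X_ne_zero)
      (hf _ (Polynomial.C_ne_zero.2 ht)), apply_ite f, map_mul, map_pow, map_zt, map_zero]
    · simpa using congrArg (fun c => f (Polynomial.C c)) hy
    · simpa using congrArg (fun c => f (Polynomial.C c)) hz
  have := congrArg (Polynomial.aeval u).toRingHom h
  rw [map_dualSum, apply_ite (Polynomial.aeval u).toRingHom, map_mul, map_pow, map_zt,
    map_zero] at this
  simpa using this

/-! ### Interchanging the sums -/

section Expansion

/-- Summing translates against the polynomials `P_ν` means applying all difference operators. -/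
theorem sum_P_mul (t : ℂ) (F : Weight → ℂ) :
    ∑ ν ∈ S₀, Polynomial.aeval t (P ν) * F ν =
      ∑ S ∈ posRoots.powerset, (-t) ^ S.card * F (∑ α ∈ S, α) := by
  have hD : tDenominator = ∑ S ∈ posRoots.powerset,
      AddMonoidAlgebra.single (-∑ α ∈ S, α) ((-Polynomial.X) ^ S.card) := by
    simp only [tDenominator, sub_eq_add_neg]
    rw [Finset.prod_one_add]
    refine Finset.sum_congr rfl fun S hS => ?_
    clear hS
    induction S using Finset.induction_on with
    | empty => simp [AddMonoidAlgebra.one_def]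
    | insert α S hα ih =>
      rw [Finset.prod_insert hα, ih, Finset.sum_insert hα, Finset.card_insert_of_notMem hα,
        ← AddMonoidAlgebra.single_neg, AddMonoidAlgebra.single_mul_single, neg_add, pow_succ']
  have hP (ν : Weight) : Polynomial.aeval t (P ν) =
      ∑ S ∈ posRoots.powerset, if ∑ α ∈ S, α = ν then (-t) ^ S.card else 0 := by
    rw [P, hD, AddMonoidAlgebra.coeff_sum, Finset.sum_apply', map_sum]
    refine Finset.sum_congr rfl fun S _ => ?_
    rw [AddMonoidAlgebra.coeff_single, Finsupp.single_apply]
    simp only [neg_inj]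
    split_ifs <;> simp
  simp only [hP, Finset.sum_mul]
  rw [Finset.sum_comm]
  refine Finset.sum_congr rfl fun S hS => ?_
  simp only [ite_mul, zero_mul]
  rw [Finset.sum_ite_eq, if_pos]
  exact Finset.mem_image_of_mem (fun S => ∑ α ∈ S, α) hS

end Expansion

/-- The embedding `(a, b) ↦ a ϖ₁ + b ϖ₂ + ρ` onto the strictly dominant weights. -/
def shift (ab : ℕ × ℕ) : Weight := ![(ab.1 : ℤ) + 1, (ab.2 : ℤ) + 1]

theorem shift_injective : Function.Injective shift := by
  rintro ⟨a, b⟩ ⟨c, d⟩ h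
  have h0 := congrFun h 0
  have h1 := congrFun h 1
  simp only [shift, Matrix.cons_val_zero, Matrix.cons_val_one] at h0 h1
  ext <;> simp only <;> omega

theorem mem_range_shift {μ : Weight} (h0 : 0 < μ 0) (h1 : 0 < μ 1) : μ ∈ Set.range shift := by
  refine ⟨((μ 0 - 1).toNat, (μ 1 - 1).toNat), ?_⟩
  rw [← eta_weight μ]
  ext k
  fin_cases k <;> simp [shift] <;> omega

section Extension

variable {R : Type*} [CommRing R]

/-- The function on the weight lattice that takes the value `c a b` at `a ϖ₁ + b ϖ₂ + ρ` and
vanishes at the weights that are not strictly dominant. -/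
def domExt (c : ℕ → ℕ → R) (μ : Weight) : R :=
  if 0 < μ 0 ∧ 0 < μ 1 then c (μ 0 - 1).toNat (μ 1 - 1).toNat else 0

theorem domExt_shift (c : ℕ → ℕ → R) (ab : ℕ × ℕ) : domExt c (shift ab) = c ab.1 ab.2 := by
  have h (k : ℕ) : (0 : ℤ) < k + 1 := by omega
  simp [domExt, shift, h]

theorem domExt_of_notMem (c : ℕ → ℕ → R) {μ : Weight} (h : μ ∉ Set.range shift) :
    domExt c μ = 0 :=
  if_neg fun hμ => h (mem_range_shift hμ.1 hμ.2)

theorem kern_of_notMem (y z u t : R) {μ : Weight} (h : μ ∉ Set.range shift) :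
    kern y z u t μ = 0 :=
  if_neg fun hμ => h (mem_range_shift hμ.1 hμ.2)

theorem map_domExt {R' : Type*} [CommRing R'] (f : R →+* R') (c : ℕ → ℕ → R) (μ : Weight) :
    f (domExt c μ) = domExt (fun a b => f (c a b)) μ := by
  simp only [domExt, apply_ite f, map_zero]

theorem signedChar_eq (χ : ℕ → ℕ → ℂ) (μ : Weight) :
    signedChar χ μ = ∑ w ∈ weylGroup, (w.det : ℂ) * domExt χ (w.mulVec μ) := by
  simp only [signedChar, domExt, mul_ite, mul_zero]
  rfl

end Extension

/-- The Weyl group has exponent `6`, so that fifth powers are inverses. -/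
theorem weylGroup_pow_five : ∀ w ∈ weylGroup, w ^ 5 ∈ weylGroup ∧ w ^ 5 * w = 1 ∧ w * w ^ 5 = 1 ∧
    (w ^ 5) ^ 5 = w ∧ (w ^ 5).det = w.det := by
  decide

/-- The affine bijection `ν ↦ w⁻¹ ν + σ` of the weight lattice. -/
def affineEquiv (w : Matrix (Fin 2) (Fin 2) ℤ) (hw : w ∈ weylGroup) (σ : Weight) :
    Weight ≃ Weight where
  toFun ν := (w ^ 5).mulVec ν + σ
  invFun μ := w.mulVec (μ - σ)
  left_inv ν := by
    beta_reduce
    rw [add_sub_cancel_right, Matrix.mulVec_mulVec, (weylGroup_pow_five w hw).2.2.1,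
      Matrix.one_mulVec]
  right_inv μ := by
    beta_reduce
    rw [Matrix.mulVec_mulVec, (weylGroup_pow_five w hw).2.1, Matrix.one_mulVec, sub_add_cancel]

section Swap

variable {R : Type*} [CommRing R] [TopologicalSpace R]

/-- Reindexing one term of the Weyl group sum by the highest weight of the character it
contributes. -/
theorem hasSum_reindex (c : ℕ → ℕ → R) {F : Weight → R}
    (hF : ∀ μ ∉ Set.range shift, F μ = 0) {w : Matrix (Fin 2) (Fin 2) ℤ} (hw : w ∈ weylGroup)
    (σ : Weight) {s : R}
    (h : HasSum (fun nm => domExt c (w.mulVec (shift nm - σ)) * F (shift nm)) s) :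
    HasSum (fun ab : ℕ × ℕ => c ab.1 ab.2 * F ((w ^ 5).mulVec (shift ab) + σ)) s := by
  have h1 : HasSum (fun μ => domExt c (w.mulVec (μ - σ)) * F μ) s := by
    rw [← shift_injective.hasSum_iff]
    · exact h
    · intro μ hμ
      rw [hF μ hμ, mul_zero]
  rw [← (affineEquiv w hw σ).hasSum_iff, ← shift_injective.hasSum_iff] at h1
  · refine (congrArg (HasSum · _) (funext fun ab => ?_)).mpr h1
    have := (affineEquiv w hw σ).left_inv (shift ab)
    simp only [affineEquiv] at this
    simp only [Function.comp_apply, affineEquiv, Equiv.coe_fn_mk, this, domExt_shift]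
  · intro μ hμ
    have := (affineEquiv w hw σ).left_inv μ
    simp only [affineEquiv] at this
    simp only [Function.comp_apply, affineEquiv, Equiv.coe_fn_mk, this, domExt_of_notMem c hμ,
      zero_mul]

/-- Interchange of the sum over `ϖ` with the sum over the highest weights of the characters: the
difference operators and the Weyl group sum move from `c` to `F`. -/
theorem exists_hasSum_swap [IsTopologicalRing R] (t : R) (c : ℕ → ℕ → R) {F : Weight → R}
    (hF : ∀ μ ∉ Set.range shift, F μ = 0)
    (h : ∀ S ⊆ posRoots, ∀ w ∈ weylGroup,
      Summable fun nm => domExt c (w.mulVec (shift nm - ∑ α ∈ S, α)) * F (shift nm)) :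
    ∃ s : R,
      HasSum (fun nm => (∑ S ∈ posRoots.powerset, (-t) ^ S.card *
        ∑ w ∈ weylGroup, (w.det : R) * domExt c (w.mulVec (shift nm - ∑ α ∈ S, α))) *
          F (shift nm)) s ∧
      HasSum (fun ab => c ab.1 ab.2 *
        ∑ w ∈ weylGroup, (w.det : R) * diffSum t posRoots F (w.mulVec (shift ab))) s := by
  choose! s hs using h
  refine ⟨∑ S ∈ posRoots.powerset, ∑ w ∈ weylGroup, (-t) ^ S.card * (w.det : R) * s S w, ?_, ?_⟩
  · have := hasSum_sum fun S hS => hasSum_sum fun w hw =>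
      (hs S (Finset.mem_powerset.1 hS) w hw).mul_left ((-t) ^ S.card * (w.det : R))
    refine (congrArg (HasSum · _) (funext fun nm => ?_)).mpr this
    simp only [Finset.sum_mul, Finset.mul_sum]
    refine Finset.sum_congr rfl fun S _ => Finset.sum_congr rfl fun w _ => ?_
    ring
  · have := hasSum_sum fun S hS => hasSum_sum fun w hw =>
      (hasSum_reindex c hF hw _ (hs S (Finset.mem_powerset.1 hS) w hw)).mul_left
        ((-t) ^ S.card * (w.det : R))
    refine (congrArg (HasSum · _) (funext fun ab => ?_)).mpr this
    rw [Finset.sum_comm, Finset.mul_sum]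
    refine Finset.sum_nbij' (· ^ 5) (· ^ 5) (fun w hw => (weylGroup_pow_five w hw).1)
      (fun w hw => (weylGroup_pow_five w hw).1) (fun w hw => (weylGroup_pow_five w hw).2.2.2.1)
      (fun w hw => (weylGroup_pow_five w hw).2.2.2.1) fun w hw => ?_
    simp only [diffSum, (weylGroup_pow_five w hw).2.2.2.1, (weylGroup_pow_five w hw).2.2.2.2,
      Finset.mul_sum]
    refine Finset.sum_congr rfl fun S _ => ?_
    ring

end Swap

/-! ### The expansion of the left-hand side -/

section Specialize

variable {R : Type*} [CommRing R]

theorem wt_eq {x q t : R} (h : q * t = 1) (n m : ℕ) :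
    wt (x * q ^ 8) t n m = I₀ n m x q * x ^ (n + 2 * m) * q ^ (8 * n + 15 * m) := by
  have h7 : x * q ^ 8 * t = x * q ^ 7 := by linear_combination (x * q ^ 7) * h
  have h6 : x * q ^ 8 * t ^ 2 = x * q ^ 6 := by
    linear_combination (x * q ^ 7 * t + x * q ^ 6) * h
  have h5 : x * q ^ 8 * t ^ 3 = x * q ^ 5 := by
    linear_combination (x * q ^ 7 * t ^ 2 + x * q ^ 6 * t + x * q ^ 5) * h
  have h3 : (x * q ^ 8) ^ 3 * t ^ 3 = x ^ 3 * q ^ 21 := by rw [← mul_pow, h7]; ring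
  have h2 : (x * q ^ 8) ^ 2 * t = x ^ 2 * q ^ 15 := by rw [sq, mul_assoc, h7]; ring
  rw [wt, I₀, h7, h6, h5, h3, h2]
  ring

theorem zt_eq {x q t : R} (h : q * t = 1) : zt (x * q ^ 8) t = z₀ x q := by
  have h7 : x * q ^ 8 * t = x * q ^ 7 := by linear_combination (x * q ^ 7) * h
  have h6 : x * q ^ 8 * t ^ 2 = x * q ^ 6 := by
    linear_combination (x * q ^ 7 * t + x * q ^ 6) * h
  have h5 : x * q ^ 8 * t ^ 3 = x * q ^ 5 := by
    linear_combination (x * q ^ 7 * t ^ 2 + x * q ^ 6 * t + x * q ^ 5) * h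
  rw [zt, z₀, ← mul_pow, ← mul_pow, h7, h6, h5]
  ring

end Specialize

theorem one_add_inv_ne_zero {q : ℂ} (hq : 1 < ‖q‖) : 1 + q⁻¹ ≠ 0 := by
  intro h
  have : ‖q⁻¹‖ = 1 := by rw [eq_neg_of_add_eq_zero_right h, norm_neg, norm_one]
  rw [norm_inv, inv_eq_one] at this
  linarith

/-- The Poincaré polynomial of the Weyl group has no zero at `q⁻¹`, since its roots are roots of
unity. -/
theorem poincare_ne_zero {q : ℂ} (hq : 1 < ‖q‖) :
    (1 + q⁻¹) * (1 + q⁻¹ + q⁻¹ ^ 2 + q⁻¹ ^ 3 + q⁻¹ ^ 4 + q⁻¹ ^ 5) ≠ 0 := by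
  refine mul_ne_zero (one_add_inv_ne_zero hq) fun h => ?_
  have h6 : q⁻¹ ^ 6 = 1 := by linear_combination (q⁻¹ - 1) * h
  have : ‖q⁻¹‖ < 1 := by rw [norm_inv]; exact inv_lt_one_of_one_lt₀ hq
  have h1 : ‖q⁻¹‖ ^ 6 = 1 := by rw [← norm_pow, h6, norm_one]
  have h2 := pow_lt_one₀ (norm_nonneg _) this (n := 6) (by norm_num)
  linarith

theorem inv_Qw {q : ℂ} (hq : 1 < ‖q‖) (n m : ℕ) : (Qw q n m)⁻¹ = invQ (1 + q⁻¹)⁻¹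
    ((1 + q⁻¹) * (1 + q⁻¹ + q⁻¹ ^ 2 + q⁻¹ ^ 3 + q⁻¹ ^ 4 + q⁻¹ ^ 5))⁻¹ n m := by
  have h1 : 1 - q⁻¹ ≠ 0 := by
    intro h
    have : ‖q⁻¹‖ = 1 := by rw [← sub_eq_zero.1 h, norm_one]
    rw [norm_inv, inv_eq_one] at this
    linarith
  simp only [Qw, invQ]
  split_ifs
  · congr 1
    rw [div_eq_iff (pow_ne_zero 2 h1)]
    ring
  · rfl
  · exact inv_one

/-- The left-hand side of the identity, expanded over the characters, for any topological
algebra `R` in which the expansion converges term by term. -/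
theorem exists_hasSum_identity {q : ℂ} (hq : 1 < ‖q‖) (χ : ℕ → ℕ → ℂ) {R : Type*} [CommRing R]
    [TopologicalSpace R] [IsTopologicalRing R] [Algebra ℂ R] (x : R)
    (h : ∀ S ⊆ posRoots, ∀ w ∈ weylGroup, Summable fun nm : ℕ × ℕ =>
      algebraMap ℂ R (domExt χ (w.mulVec (shift nm - ∑ α ∈ S, α)) * (Qw q nm.1 nm.2)⁻¹) *
        (I₀ nm.1 nm.2 x (algebraMap ℂ R q) * x ^ (nm.1 + 2 * nm.2)
          * algebraMap ℂ R q ^ (8 * nm.1 + 15 * nm.2))) :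
    ∃ s : R,
      HasSum (fun nm : ℕ × ℕ => algebraMap ℂ R (p q χ nm.1 nm.2)
        * I₀ nm.1 nm.2 x (algebraMap ℂ R q) * x ^ (nm.1 + 2 * nm.2)
        * algebraMap ℂ R q ^ (8 * nm.1 + 15 * nm.2)) s ∧
      HasSum (fun r : ℕ => algebraMap ℂ R (χ r 0) * (z₀ x (algebraMap ℂ R q)
        * (x * algebraMap ℂ R q ^ 8) ^ r)) s := by
  have hq0 : q ≠ 0 := norm_pos_iff.1 (zero_lt_one.trans hq)
  set t : ℂ := q⁻¹ with ht
  have hqt : algebraMap ℂ R q * algebraMap ℂ R t = 1 := by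
    rw [← map_mul, ht, mul_inv_cancel₀ hq0, map_one]
  set y : ℂ := (1 + t)⁻¹ with hy
  set z : ℂ := ((1 + t) * (1 + t + t ^ 2 + t ^ 3 + t ^ 4 + t ^ 5))⁻¹ with hz
  set F : Weight → R := kern (algebraMap ℂ R y) (algebraMap ℂ R z) (x * algebraMap ℂ R q ^ 8)
    (algebraMap ℂ R t) with hF
  have hFs (nm : ℕ × ℕ) : F (shift nm) = algebraMap ℂ R (Qw q nm.1 nm.2)⁻¹ *
      (I₀ nm.1 nm.2 x (algebraMap ℂ R q) * x ^ (nm.1 + 2 * nm.2)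
        * algebraMap ℂ R q ^ (8 * nm.1 + 15 * nm.2)) := by
    rw [hF, shift, kern_succ, wt_eq hqt, inv_Qw hq]
    simp only [invQ, apply_ite (algebraMap ℂ R), map_one]
    rfl
  obtain ⟨s, h1, h2⟩ := exists_hasSum_swap (algebraMap ℂ R t)
    (fun a b => algebraMap ℂ R (χ a b)) (F := F) (fun μ hμ => kern_of_notMem _ _ _ _ hμ)
    (fun S hS w hw => by
      refine (summable_congr fun nm => ?_).2 (h S hS w hw)
      rw [hFs, ← map_domExt, map_mul, ← mul_assoc])
  refine ⟨s, ?_, ?_⟩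
  · refine (congrArg (HasSum · _) (funext fun nm => ?_)).mpr h1
    rw [hFs, p, sum_P_mul t fun ν => signedChar χ (![(nm.1 : ℤ), (nm.2 : ℤ)] + rho - ν)]
    have e : (![(nm.1 : ℤ), (nm.2 : ℤ)] + rho : Weight) = shift nm := by simp [rho, shift]
    simp only [e, signedChar_eq, map_mul, map_sum, map_pow, map_neg, map_intCast, map_domExt]
    ring
  · have hinj : Function.Injective fun r : ℕ => (r, 0) := fun a b h => (Prod.mk.inj h).1
    rw [← hinj.hasSum_iff] at h2
    · refine (congrArg (HasSum · _) (funext fun r => ?_)).mpr h2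
      have := dualSum_algebraMap (R := R) (inv_ne_zero hq0) (inv_mul_cancel₀ (one_add_inv_ne_zero hq))
        (inv_mul_cancel₀ (poincare_ne_zero hq)) (x * algebraMap ℂ R q ^ 8) r 0
      rw [if_pos rfl, zt_eq hqt] at this
      rw [← this]
      rfl
    · rintro ⟨r, b⟩ hb
      have := dualSum_algebraMap (R := R) (inv_ne_zero hq0) (inv_mul_cancel₀ (one_add_inv_ne_zero hq))
        (inv_mul_cancel₀ (poincare_ne_zero hq)) (x * algebraMap ℂ R q ^ 8) r b
      rw [if_neg (by rintro rfl; exact hb ⟨r, rfl⟩)] at this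
      exact mul_eq_zero_of_right _ this

/-- If `λ + ρ` and `μ + ρ` are strictly dominant and `μ + ρ` is a sum of distinct positive roots
away from the Weyl group orbit of `λ + ρ`, then `μ` is not much smaller than `λ`. The constant `20`
is not optimal. -/
theorem le_add_of_mulVec_add_eq {w : Matrix (Fin 2) (Fin 2) ℤ} (hw : w ∈ weylGroup)
    {S : Finset Weight} (hS : S ⊆ posRoots) {ab nm : ℕ × ℕ}
    (h : w.mulVec (shift ab) + ∑ α ∈ S, α = shift nm) :
    ab.1 ≤ nm.1 + 20 ∧ ab.2 ≤ nm.2 + 20 := by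
  have e0 : ∑ α ∈ posRoots, max (α 0) 0 = 6 := by decide
  have e1 : ∑ α ∈ posRoots, max (α 1) 0 = 4 := by decide
  have e2 : ∑ α ∈ posRoots, max (-α 0) 0 = 4 := by decide
  have e3 : ∑ α ∈ posRoots, max (-α 1) 0 = 2 := by decide
  have b0 := sum_apply_le hS (Pi.evalAddMonoidHom (fun _ => ℤ) 0)
  have b1 := sum_apply_le hS (Pi.evalAddMonoidHom (fun _ => ℤ) 1)
  have b2 := sum_apply_le hS (-Pi.evalAddMonoidHom (fun _ => ℤ) 0)
  have b3 := sum_apply_le hS (-Pi.evalAddMonoidHom (fun _ => ℤ) 1)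
  simp only [AddMonoidHom.neg_apply, Pi.evalAddMonoidHom_apply, e0, e1, e2, e3] at b0 b1 b2 b3
  generalize ∑ α ∈ S, α = σ at h b0 b1 b2 b3
  have h0 := congrFun h 0
  have h1 := congrFun h 1
  simp only [weylGroup_eq, Finset.mem_insert, Finset.mem_singleton] at hw
  rcases hw with rfl | rfl | rfl | rfl | rfl | rfl | rfl | rfl | rfl | rfl | rfl | rfl <;>
  · simp [shift, s₁, s₂] at h0 h1
    omega

/-! ### Convergence -/

section Complex

theorem norm_I₀_le {x q : ℂ} (h7 : ‖x * q ^ 7‖ ≤ 1) (h8 : ‖x * q ^ 8‖ ≤ 1) (n m : ℕ) :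
    ‖I₀ n m x q‖ ≤ ‖(1 - x * q ^ 6) * (1 - x ^ 3 * q ^ 21)‖ +
      ‖(1 - x * q ^ 5) * (1 - x * q ^ 6)‖ + ‖(1 - x * q ^ 8) * (1 - x * q ^ 5)‖ := by
  refine (norm_sub_le _ _).trans (add_le_add ((norm_sub_le _ _).trans (add_le_add le_rfl ?_)) ?_)
  · rw [norm_mul, norm_pow]
    exact mul_le_of_le_one_right (norm_nonneg _) (pow_le_one₀ (norm_nonneg _) h8)
  · rw [norm_mul, norm_mul, norm_pow, norm_pow, mul_assoc]
    exact mul_le_of_le_one_right (norm_nonneg _) (mul_le_one₀ (pow_le_one₀ (norm_nonneg _) h8)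
      (by positivity) (pow_le_one₀ (norm_nonneg _) h7))

theorem norm_inv_Qw_le {q : ℂ} (hq : 1 < ‖q‖) : ∃ C : ℝ, 0 ≤ C ∧ ∀ n m, ‖(Qw q n m)⁻¹‖ ≤ C := by
  refine ⟨‖(1 + q⁻¹)⁻¹‖ +
    ‖((1 + q⁻¹) * (1 + q⁻¹ + q⁻¹ ^ 2 + q⁻¹ ^ 3 + q⁻¹ ^ 4 + q⁻¹ ^ 5))⁻¹‖ + 1, by positivity,
    fun n m => ?_⟩
  rw [inv_Qw hq, invQ]
  generalize (1 + q⁻¹)⁻¹ = y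
  generalize ((1 + q⁻¹) * _)⁻¹ = z
  have hy := norm_nonneg y
  have hz := norm_nonneg z
  split_ifs
  · linarith
  · linarith
  · rw [norm_one]; linarith

theorem summable_complex {q : ℂ} (hq : 1 < ‖q‖) (χ : ℕ → ℕ → ℂ) {x : ℂ} (hx : ‖x * q ^ 8‖ ≤ 1)
    (h : Summable fun nm : ℕ × ℕ =>
      ‖χ nm.1 nm.2 * x ^ (nm.1 + 2 * nm.2) * q ^ (8 * nm.1 + 15 * nm.2)‖)
    {S : Finset Weight} (hS : S ⊆ posRoots) {w : Matrix (Fin 2) (Fin 2) ℤ} (hw : w ∈ weylGroup) :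
    Summable fun nm : ℕ × ℕ => domExt χ (w.mulVec (shift nm - ∑ α ∈ S, α)) * (Qw q nm.1 nm.2)⁻¹ *
      (I₀ nm.1 nm.2 x q * x ^ (nm.1 + 2 * nm.2) * q ^ (8 * nm.1 + 15 * nm.2)) := by
  -- at `x = 0` only the term at `(0, 0)` is nonzero
  rcases eq_or_ne x 0 with rfl | hx0
  · refine summable_of_ne_finset_zero (s := {(0, 0)}) fun nm hnm => ?_
    have : nm.1 + 2 * nm.2 ≠ 0 := by
      contrapose! hnm
      rw [Finset.mem_singleton, Prod.ext_iff]
      simp only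
      omega
    simp [zero_pow this]
  have hq0 : q ≠ 0 := norm_pos_iff.1 (zero_lt_one.trans hq)
  have h7 : ‖x * q ^ 7‖ ≤ 1 := by
    refine le_trans ?_ hx
    rw [norm_mul, norm_mul, norm_pow, norm_pow]
    gcongr
    · exact hq.le
    · norm_num
  set r : ℝ := ‖x * q ^ 8‖ with hr
  set s : ℝ := ‖x ^ 2 * q ^ 15‖ with hs
  have hr0 : 0 < r := norm_pos_iff.2 (by simp [hx0, hq0])
  have hs0 : 0 < s := norm_pos_iff.2 (by simp [hx0, hq0])
  have hs1 : s ≤ 1 := by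
    rw [hs, show x ^ 2 * q ^ 15 = (x * q ^ 8) * (x * q ^ 7) by ring, norm_mul]
    exact mul_le_one₀ hx (norm_nonneg _) h7
  have hnorm (n m : ℕ) : ‖x ^ (n + 2 * m) * q ^ (8 * n + 15 * m)‖ = r ^ n * s ^ m := by
    rw [hr, hs, ← norm_pow, ← norm_pow, ← norm_mul]
    congr 1
    ring
  obtain ⟨C, hC, hQ⟩ := norm_inv_Qw_le hq
  set D : ℝ := ‖(1 - x * q ^ 6) * (1 - x ^ 3 * q ^ 21)‖ +
      ‖(1 - x * q ^ 5) * (1 - x * q ^ 6)‖ + ‖(1 - x * q ^ 8) * (1 - x * q ^ 5)‖ with hD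
  have hD0 : 0 ≤ D := by positivity
  set ψ : Weight → ℝ := domExt fun a b => ‖χ a b * x ^ (a + 2 * b) * q ^ (8 * a + 15 * b)‖ with hψ
  have hψs : Summable ψ := by
    rw [← shift_injective.summable_iff fun μ hμ => domExt_of_notMem _ hμ]
    refine h.congr fun ab => ?_
    rw [Function.comp_apply, domExt_shift]
  have hinj : Function.Injective fun nm => w.mulVec (shift nm - ∑ α ∈ S, α) :=
    (affineEquiv w hw (∑ α ∈ S, α)).symm.injective.comp shift_injective
  refine Summable.of_norm_bounded ((hψs.comp_injective hinj).mul_left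
    (C * D * (r ^ 20 * s ^ 20)⁻¹)) fun nm => ?_
  have key : ‖domExt χ (w.mulVec (shift nm - ∑ α ∈ S, α))‖ * (r ^ nm.1 * s ^ nm.2) ≤
      (r ^ 20 * s ^ 20)⁻¹ * ψ (w.mulVec (shift nm - ∑ α ∈ S, α)) := by
    by_cases hν : w.mulVec (shift nm - ∑ α ∈ S, α) ∈ Set.range shift
    · obtain ⟨ab, hab⟩ := hν
      have e := (affineEquiv w hw (∑ α ∈ S, α)).right_inv (shift nm)
      simp only [affineEquiv, ← hab] at e
      obtain ⟨ha, hb⟩ := le_add_of_mulVec_add_eq (weylGroup_pow_five w hw).1 hS e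
      rw [← hab, domExt_shift, hψ, domExt_shift, mul_assoc (χ _ _), norm_mul, hnorm,
        le_inv_mul_iff₀ (by positivity)]
      have h1 : r ^ (nm.1 + 20) ≤ r ^ ab.1 := pow_le_pow_of_le_one hr0.le hx ha
      have h2 : s ^ (nm.2 + 20) ≤ s ^ ab.2 := pow_le_pow_of_le_one hs0.le hs1 hb
      calc r ^ 20 * s ^ 20 * (‖χ ab.1 ab.2‖ * (r ^ nm.1 * s ^ nm.2))
          = ‖χ ab.1 ab.2‖ * (r ^ (nm.1 + 20) * s ^ (nm.2 + 20)) := by ring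
        _ ≤ ‖χ ab.1 ab.2‖ * (r ^ ab.1 * s ^ ab.2) := by gcongr
    · rw [domExt_of_notMem _ hν, hψ, domExt_of_notMem _ hν]
      simp
  rw [mul_assoc (I₀ _ _ _ _), norm_mul, norm_mul, norm_mul, hnorm, Function.comp_apply]
  calc _ = ‖(Qw q nm.1 nm.2)⁻¹‖ * ‖I₀ nm.1 nm.2 x q‖ *
        (‖domExt χ (w.mulVec (shift nm - ∑ α ∈ S, α))‖ * (r ^ nm.1 * s ^ nm.2)) := by ring
    _ ≤ C * D * ((r ^ 20 * s ^ 20)⁻¹ * ψ (w.mulVec (shift nm - ∑ α ∈ S, α))) := by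
      gcongr
      · exact hQ _ _
      · exact norm_I₀_le h7 hx _ _
    _ = _ := by ring

theorem hasSum_complex {q : ℂ} (hq : 1 < ‖q‖) (χ : ℕ → ℕ → ℂ) {x : ℂ} (hx : ‖x * q ^ 8‖ ≤ 1)
    (h : Summable fun nm : ℕ × ℕ =>
      ‖χ nm.1 nm.2 * x ^ (nm.1 + 2 * nm.2) * q ^ (8 * nm.1 + 15 * nm.2)‖) :
    Summable (fun r : ℕ => χ r 0 * x ^ r * q ^ (8 * r)) ∧
      HasSum (fun nm : ℕ × ℕ => p q χ nm.1 nm.2 * I₀ nm.1 nm.2 x q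
        * x ^ (nm.1 + 2 * nm.2) * q ^ (8 * nm.1 + 15 * nm.2))
      (z₀ x q * ∑' r : ℕ, χ r 0 * x ^ r * q ^ (8 * r)) := by
  have hinj : Function.Injective fun r : ℕ => (r, 0) := fun a b h => (Prod.mk.inj h).1
  have hsum : Summable (fun r : ℕ => χ r 0 * x ^ r * q ^ (8 * r)) :=
    (h.of_norm.comp_injective hinj).congr fun r => by simp
  obtain ⟨s, h1, h2⟩ := exists_hasSum_identity hq χ (R := ℂ) x
    fun S hS w hw => summable_complex hq χ hx h hS hw
  refine ⟨hsum, ?_⟩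
  have h3 : s = z₀ x q * ∑' r : ℕ, χ r 0 * x ^ r * q ^ (8 * r) := by
    refine h2.unique ((congrArg (HasSum · _) (funext fun r => ?_)).mpr
      (hsum.hasSum.mul_left (z₀ x q)))
    simp only [Algebra.algebraMap_self_apply]
    ring
  exact h3 ▸ h1

end Complex

theorem hasSum_powerSeries {q : ℂ} (hq : 1 < ‖q‖) (χ : ℕ → ℕ → ℂ) :
    HasSum (fun nm : ℕ × ℕ => PowerSeries.C (p q χ nm.1 nm.2)
        * I₀ nm.1 nm.2 (PowerSeries.X : PowerSeries ℂ) (PowerSeries.C q)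
        * PowerSeries.X ^ (nm.1 + 2 * nm.2) * PowerSeries.C q ^ (8 * nm.1 + 15 * nm.2))
      (z₀ (PowerSeries.X : PowerSeries ℂ) (PowerSeries.C q)
        * PowerSeries.mk (fun r => χ r 0 * q ^ (8 * r))) := by
  have hC : algebraMap ℂ (PowerSeries ℂ) = PowerSeries.C := rfl
  obtain ⟨s, h1, h2⟩ := exists_hasSum_identity hq χ (R := PowerSeries ℂ) PowerSeries.X
    fun S hS w hw => by
      rw [PowerSeries.WithPiTopology.summable_iff_summable_coeff]
      intro d
      refine summable_of_ne_finset_zero (s := Finset.Iic (d, d)) fun nm hnm => ?_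
      have hd : d < nm.1 + 2 * nm.2 := by
        contrapose! hnm
        rw [Finset.mem_Iic, Prod.le_def]
        simp only
        omega
      rw [mul_right_comm _ (PowerSeries.X ^ _), ← mul_assoc, PowerSeries.coeff_mul_X_pow',
        if_neg (by omega)]
  rw [hC] at h1 h2
  have h3 : s = z₀ (PowerSeries.X : PowerSeries ℂ) (PowerSeries.C q)
        * PowerSeries.mk (fun r => χ r 0 * q ^ (8 * r)) := by
    refine h2.unique ((congrArg (HasSum · _) (funext fun r => ?_)).mpr
      ((PowerSeries.hasSum_of_monomials_self
        (PowerSeries.mk (fun r => χ r 0 * q ^ (8 * r)))).mul_left _))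
    rw [PowerSeries.coeff_mk, PowerSeries.monomial_eq_C_mul_X_pow, map_mul, map_pow]
    ring
  exact h3 ▸ h1

end G2Unramified

theorem mainTheorem5 (q : ℂ) (hq : 1 < ‖q‖)
    (V : ℕ → ℕ → Type*) [∀ n m, AddCommGroup (V n m)] [∀ n m, Module ℂ (V n m)]
    (σ : ∀ n m, Representation ℂ G2Unramified.G2 (V n m))
    (hσ : ∀ n m, G2Unramified.IsIrrepOfHighestWeight (σ n m) n m)
    (τ : G2Unramified.G2)
    (χ : ℕ → ℕ → ℂ) (hχ : ∀ n m, χ n m = (σ n m).character τ) :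
    -- the identity of formal power series in `x`
    HasSum (fun nm : ℕ × ℕ =>
        PowerSeries.C (G2Unramified.p q χ nm.1 nm.2)
          * G2Unramified.I₀ nm.1 nm.2 (PowerSeries.X : PowerSeries ℂ) (PowerSeries.C q)
          * PowerSeries.X ^ (nm.1 + 2 * nm.2) * PowerSeries.C q ^ (8 * nm.1 + 15 * nm.2))
      (G2Unramified.z₀ (PowerSeries.X : PowerSeries ℂ) (PowerSeries.C q)
        * PowerSeries.mk (fun r => χ r 0 * q ^ (8 * r)))
    ∧
    -- the identity of convergent series, for complex `x`
    ∀ x : ℂ, ‖x * q ^ 8‖ ≤ 1 →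
      Summable (fun nm : ℕ × ℕ =>
        ‖χ nm.1 nm.2 * x ^ (nm.1 + 2 * nm.2) * q ^ (8 * nm.1 + 15 * nm.2)‖) →
      Summable (fun r : ℕ => χ r 0 * x ^ r * q ^ (8 * r)) ∧
      HasSum (fun nm : ℕ × ℕ =>
          G2Unramified.p q χ nm.1 nm.2 * G2Unramified.I₀ nm.1 nm.2 x q
            * x ^ (nm.1 + 2 * nm.2) * q ^ (8 * nm.1 + 15 * nm.2))
        (G2Unramified.z₀ x q * ∑' r : ℕ, χ r 0 * x ^ r * q ^ (8 * r)) := by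
  exact ⟨G2Unramified.hasSum_powerSeries hq χ,
    fun _ hx h => G2Unramified.hasSum_complex hq χ hx h⟩
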